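/- Fix a finite set $\Sigma$ of edge labels. A graph is a pair $G=(V,E)$ with $V$ a finite set and $E\subseteq V\times\Sigma\times V$. Regular bag expressions (RBE) over a finite alphabet $\Delta$ are given by $E::=\epsilon\mid a\mid E^*\mid (E\,|\,E)\mid (E\,\|\,E)$ with $a\in\Delta$; they denote sets of finite bags over $\Delta$, where $L(\epsilon)$ contains only the empty bag, $L(a)$ contains only the bag consisting of one $a$, $|$ is union, $\|$ is elementwise bag sum, and $L(E^*)=\bigcup_{i\ge 0}L(E)^i$. A schema over $\Sigma$ is a pair $S=(\Gamma,\delta)$ with $\Gamma$ a finite (possibly empty) set of types and $\delta$ a map from $\Gamma$ to bag languages over $\Sigma\times\Gamma$; it is a shape expression schema (ShEx) if every $\delta(t)$ is the language of an RBE. A valid s-typing of $G$ w.r.t. $S$ is a map $\lambda:V\to\Gamma$ such that for every $n\in V$ the bag $\{|(a,\lambda(m)) : (n,a,m)\in E|\}$ (one occurrence per outgoing edge) lies in $\delta(\lambda(n))$. A valid m-typing is a map $\lambda:V\to 2^\Gamma$ with $\lambda(n)\ne\emptyset$ for all $n$, such that for every $n\in V$ and $t\in\lambda(n)$ one can choose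 a type $t_{a,m}\in\lambda(m)$ for every edge $(n,a,m)\in E$ so that the bag $\{|(a,t_{a,m}) : (n,a,m)\in E|\}$ lies in $\delta(t)$. Let $L_s(S)$, respectively $L_m(S)$, be the family of graphs that have a valid s-typing, respectively m-typing, and let $\mathrm{ShEx}_s=\{L_s(S): S \text{ a ShEx over } \Sigma\}$ and $\mathrm{ShEx}_m=\{L_m(S): S\text{ a ShEx over }\Sigma\}$. For bag languages $L_1$ over $\Sigma\times\Gamma_1$ and $L_2$ over $\Sigma\times\Gamma_2$, the distributing join $L_1\Join L_2$ is the set of bags $w$ over $\Sigma\times(\Gamma_1\times\Gamma_2)$ whose aggregating projections (images as bags, adding multiplicities, under $(a,(t_1,t_2))\mapsto(a,t_1)$ and $(a,(t_1,t_2))\mapsto(a,t_2)$) lie in $L_1$ and $L_2$ respectively. The product of $S_1=(\Gamma_1,\delta_1)$ and $S_2=(\Gamma_2,\delta_2)$ is the schema $S_1\cap S_2=(\Gamma_1\times\Gamma_2,\delta_\cap)$ with $\delta_\cap(t_1,t_2)=\delta_1(t_1)\Join\delta_2(t_2)$. **Theorem.** Both $\mathrm{ShEx}_s$ and $\mathrm{ShEx}_m$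 are closed under (binary) intersection. Moreover, for any two schemas $S_1,S_2$ over $\Sigma$, $L_s(S_1\cap S_2)=L_s(S_1)\cap L_s(S_2)$ and $L_m(S_1\cap S_2)=L_m(S_1)\cap L_m(S_2)$; and, for finite $\Gamma_1,\Gamma_2$, if $L_1$ and $L_2$ are RBE-definable over $\Sigma\times\Gamma_1$ and $\Sigma\times\Gamma_2$ and $L_1\Join L_2$ is nonempty, then $L_1\Join L_2$ is RBE-definable over $\Sigma\times(\Gamma_1\times\Gamma_2)$. -/

import Mathlib

universe u v w

/-- Regular bag expressions over an alphabet `Δ`: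
`E ::= ε | a | E* | (E "|" E) | (E "||" E)`. -/
inductive RBE (Δ : Type u) : Type u
  | eps : RBE Δ
  | sym : Δ → RBE Δ
  | star : RBE Δ → RBE Δ
  | alt : RBE Δ → RBE Δ → RBE Δ
  | conc : RBE Δ → RBE Δ → RBE Δ

namespace ShEx

/-- A bag language over `Δ` (bags are finite multisets). -/
abbrev BagLang (Δ : Type u) : Type u := Set (Multiset Δ)

/-- Unordered concatenation `L₁ ⊎ L₂` of bag languages. -/
def bagConc {Δ : Type u} (L₁ L₂ : BagLang Δ) : BagLang Δ :=
  {x | ∃ x₁ ∈ L₁, ∃ x₂ ∈ L₂, x = x₁ + x₂}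

/-- The iterated unordered concatenation `L ^ i`. -/
def bagPow {Δ : Type u} (L : BagLang Δ) : ℕ → BagLang Δ
  | 0 => {0}
  | i + 1 => bagConc (bagPow L i) L

end ShEx

/-- The bag language of a regular bag expression. -/
def RBE.lang {Δ : Type u} : RBE Δ → ShEx.BagLang Δ
  | .eps => {0}
  | .sym a => {{a}}
  | .star E => ⋃ i : ℕ, ShEx.bagPow E.lang i
  | .alt E₁ E₂ => E₁.lang ∪ E₂.lang
  | .conc E₁ E₂ => ShEx.bagConc E₁.lang E₂.lang

namespace ShEx

/-- `L` belongs to the class RBE of bag languages definable by regular bag expressions. -/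
def IsRBE {Δ : Type u} (L : BagLang Δ) : Prop := ∃ E : RBE Δ, E.lang = L

/-- A finite edge-labeled graph `G = (V, E)` with `E ⊆ V × Lab × V`. -/
structure LGraph (Lab : Type u) : Type (max u (v + 1)) where
  V : Type v
  finV : Finite V
  E : Set (V × Lab × V)

attribute [instance] LGraph.finV

/-- The labeled outbound neighbourhood `{(a, m) | (n, a, m) ∈ E}` of a node `n`. -/
def LGraph.outLabNode {Lab : Type u} (G : LGraph.{u, v} Lab) (n : G.V) : Set (Lab × G.V) :=
  {p | (n, p.1, p.2) ∈ G.E}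

/-- The labeled and typed out-neighbourhood `{| (a, typ m) | (n, a, m) ∈ E |}` of a node `n`,
a bag with one occurrence for every outgoing edge of `n`. -/
noncomputable def LGraph.outLabType {Lab : Type u} [Finite Lab] (G : LGraph.{u, v} Lab)
    {T : Type w} (typ : G.V → T) (n : G.V) : Multiset (Lab × T) :=
  (Set.toFinite (G.outLabNode n)).toFinset.val.map fun p => (p.1, typ p.2)

/-- `y` is a flattening of the bag `x` over `Lab × 2^Γ`: it is obtained by choosing one type
from every occurrence of every set. -/
def IsFlattening {Lab : Type u} {Γ : Type w} (x : Multiset (Lab × Set Γ))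
    (y : Multiset (Lab × Γ)) : Prop :=
  Multiset.Rel (fun p q => q.1 = p.1 ∧ q.2 ∈ p.2) x y

/-- The set of all flattenings of the out-neighbourhood of `n` for a multi-type typing. -/
def LGraph.outLabTypes {Lab : Type u} [Finite Lab] (G : LGraph.{u, v} Lab)
    {Γ : Type w} (typ : G.V → Set Γ) (n : G.V) : BagLang (Lab × Γ) :=
  {y | IsFlattening (G.outLabType typ n) y}

/-- A schema over `Lab`: a finite set `Γ` of types and a type definition function `δ` that maps
types to bag languages over `Lab × Γ`. -/
structure Schema (Lab : Type u) : Type (max u (w + 1)) where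
  Γ : Type w
  finΓ : Finite Γ
  δ : Γ → BagLang (Lab × Γ)

attribute [instance] Schema.finΓ

/-- `S` is a shape expression schema: every type is defined by a regular bag expression. -/
def Schema.IsShEx {Lab : Type u} (S : Schema.{u, w} Lab) : Prop := ∀ t, IsRBE (S.δ t)

/-- Valid single-type typings. -/
def Schema.ValidS {Lab : Type u} [Finite Lab] (S : Schema.{u, w} Lab) (G : LGraph.{u, v} Lab)
    (typ : G.V → S.Γ) : Prop :=
  ∀ n, G.outLabType typ n ∈ S.δ (typ n)

/-- Valid multi-type typings. -/
def Schema.ValidM {Lab : Type u} [Finite Lab] (S : Schema.{u, w} Lab) (G : LGraph.{u, v} Lab)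
    (typ : G.V → Set S.Γ) : Prop :=
  (∀ n, (typ n).Nonempty) ∧ ∀ n, ∀ t ∈ typ n, (G.outLabTypes typ n ∩ S.δ t).Nonempty

/-- The graphs that have a valid single-type typing. -/
def Schema.langS {Lab : Type u} [Finite Lab] (S : Schema.{u, w} Lab) : Set (LGraph.{u, v} Lab) :=
  {G | ∃ typ, S.ValidS G typ}

/-- The graphs that have a valid multi-type typing. -/
def Schema.langM {Lab : Type u} [Finite Lab] (S : Schema.{u, w} Lab) : Set (LGraph.{u, v} Lab) :=
  {G | ∃ typ, S.ValidM G typ}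

/-- The class of graph languages definable by shape expression schemas under the single-type
semantics. -/
def ShExS (Lab : Type u) [Finite Lab] : Set (Set (LGraph.{u, v} Lab)) :=
  {K | ∃ S : Schema.{u, w} Lab, S.IsShEx ∧ S.langS = K}

/-- The class of graph languages definable by shape expression schemas under the multi-type
semantics. -/
def ShExM (Lab : Type u) [Finite Lab] : Set (Set (LGraph.{u, v} Lab)) :=
  {K | ∃ S : Schema.{u, w} Lab, S.IsShEx ∧ S.langM = K}

/-- Aggregating projection on the labels and the first type component; the multiplicity of
`(a, t₁)` is the sum of the multiplicities of all `(a, (t₁, t₂))`. -/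
def aggFst {Lab : Type u} {Γ₁ Γ₂ : Type w} (x : Multiset (Lab × (Γ₁ × Γ₂))) :
    Multiset (Lab × Γ₁) :=
  x.map fun p => (p.1, p.2.1)

/-- Aggregating projection on the labels and the second type component. -/
def aggSnd {Lab : Type u} {Γ₁ Γ₂ : Type w} (x : Multiset (Lab × (Γ₁ × Γ₂))) :
    Multiset (Lab × Γ₂) :=
  x.map fun p => (p.1, p.2.2)

/-- The distributing join `L₁ ⋈ L₂`. -/
def distJoin {Lab : Type u} {Γ₁ Γ₂ : Type w} (L₁ : BagLang (Lab × Γ₁)) (L₂ : BagLang (Lab × Γ₂)) :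
    BagLang (Lab × (Γ₁ × Γ₂)) :=
  {x | aggFst x ∈ L₁ ∧ aggSnd x ∈ L₂}

/-- The product schema: its types are pairs of types, and the definition of a pair is the
distributing join of the two definitions. -/
def Schema.prod {Lab : Type u} (S₁ S₂ : Schema.{u, w} Lab) : Schema.{u, w} Lab where
  Γ := S₁.Γ × S₂.Γ
  finΓ := inferInstance
  δ := fun t => distJoin (S₁.δ t.1) (S₂.δ t.2)

end ShEx

/-! RBE languages are semilinear, and every nonempty semilinear set of bags is RBE-definable. The
distributing join is the intersection of two preimages under the aggregating projections, which are
homomorphisms, so it is semilinear (`isSemilinearSet_distJoin`). Pairing typings and projecting them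
shows that the product schema defines the intersection.

One obstacle remains: no RBE denotes the empty language, but a join may be empty. Deleting a type
removes bags from the other definitions and may empty these in turn, so the product is restricted to
its largest self-supporting set of types (`Schema.trim`). Its definitions are nonempty, and no valid
typing is lost, since the types used by one form a self-supporting set. -/

/-! ### RBE languages and semilinear sets -/

open Pointwise in
theorem ShEx.bagConc_eq_add {Δ : Type u} (L₁ L₂ : ShEx.BagLang Δ) :
    ShEx.bagConc L₁ L₂ = L₁ + L₂ := by
  ext x
  simp only [ShEx.bagConc, Set.mem_ofPred_eq, Set.mem_add, eq_comm]

/-- Turns the star into a generated submonoid, an operation that preserves semilinearity. -/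
theorem ShEx.iUnion_bagPow {Δ : Type u} (L : ShEx.BagLang Δ) :
    ⋃ i : ℕ, ShEx.bagPow L i = (AddSubmonoid.closure L : Set (Multiset Δ)) := by
  apply Set.Subset.antisymm
  · refine Set.iUnion_subset fun i => ?_
    induction i with
    | zero =>
      rintro x rfl
      exact zero_mem _
    | succ i ih =>
      rintro x ⟨y, hy, z, hz, rfl⟩
      exact add_mem (ih hy) (AddSubmonoid.subset_closure hz)
  · intro x hx
    induction hx using AddSubmonoid.closure_induction_right with
    | zero => exact Set.mem_iUnion.2 ⟨0, rfl⟩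
    | add_right y _ z hz ih =>
      obtain ⟨i, hi⟩ := Set.mem_iUnion.1 ih
      exact Set.mem_iUnion.2 ⟨i + 1, y, hi, z, hz, rfl⟩

/-- The language of a regular bag expression is semilinear. -/
theorem RBE.isSemilinearSet_lang {Δ : Type u} (E : RBE Δ) : IsSemilinearSet E.lang := by
  induction E with
  | eps => exact IsSemilinearSet.singleton 0
  | sym a => exact IsSemilinearSet.singleton ({a} : Multiset Δ)
  | star E ih =>
    rw [RBE.lang, ShEx.iUnion_bagPow]
    exact ih.closure
  | alt E₁ E₂ ih₁ ih₂ => exact ih₁.union ih₂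
  | conc E₁ E₂ ih₁ ih₂ =>
    rw [RBE.lang, ShEx.bagConc_eq_add]
    exact ih₁.add ih₂

namespace ShEx

theorem IsRBE.isSemilinearSet {Δ : Type u} {L : BagLang Δ} (h : IsRBE L) :
    IsSemilinearSet L := by
  obtain ⟨E, rfl⟩ := h
  exact E.isSemilinearSet_lang

theorem IsRBE.union {Δ : Type u} {L₁ L₂ : BagLang Δ} (h₁ : IsRBE L₁) (h₂ : IsRBE L₂) :
    IsRBE (L₁ ∪ L₂) := by
  obtain ⟨E₁, rfl⟩ := h₁
  obtain ⟨E₂, rfl⟩ := h₂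
  exact ⟨.alt E₁ E₂, rfl⟩

open Pointwise in
theorem IsRBE.add {Δ : Type u} {L₁ L₂ : BagLang Δ} (h₁ : IsRBE L₁) (h₂ : IsRBE L₂) :
    IsRBE (L₁ + L₂) := by
  obtain ⟨E₁, rfl⟩ := h₁
  obtain ⟨E₂, rfl⟩ := h₂
  exact ⟨.conc E₁ E₂, bagConc_eq_add _ _⟩

theorem IsRBE.closure {Δ : Type u} {L : BagLang Δ} (h : IsRBE L) :
    IsRBE (AddSubmonoid.closure L : Set (Multiset Δ)) := by
  obtain ⟨E, rfl⟩ := h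
  exact ⟨.star E, iUnion_bagPow _⟩

theorem isRBE_singleton {Δ : Type u} (x : Multiset Δ) : IsRBE ({x} : Set (Multiset Δ)) := by
  induction x using Multiset.induction_on with
  | empty => exact ⟨.eps, rfl⟩
  | cons a x ih =>
    have h : IsRBE ({{a}} : Set (Multiset Δ)) := ⟨.sym a, rfl⟩
    simpa using h.add ih

theorem isRBE_closure_of_finite {Δ : Type u} {s : Set (Multiset Δ)} (hs : s.Finite) :
    IsRBE (AddSubmonoid.closure s : Set (Multiset Δ)) := by
  induction s, hs using Set.Finite.induction_on with
  | empty => simpa using isRBE_singleton (0 : Multiset Δ)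
  | @insert a s _ _ ih =>
    rw [Set.insert_eq, AddSubmonoid.closure_union, AddSubmonoid.coe_sup]
    exact (isRBE_singleton a).closure.add ih

open Pointwise in
/-- Nonempty semilinear sets of bags are definable by regular bag expressions. -/
theorem isRBE_of_isSemilinearSet {Δ : Type u} {L : BagLang Δ} (h : IsSemilinearSet L)
    (hne : L.Nonempty) : IsRBE L := by
  obtain ⟨S, hS, hlin, rfl⟩ := h
  induction S, hS using Set.Finite.induction_on with
  | empty => simp at hne
  | @insert s S _ _ ih =>
    have hs : IsRBE s := by
      obtain ⟨a, t, ht, rfl⟩ := hlin s (Set.mem_insert _ _)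
      have h := (isRBE_singleton a).add (isRBE_closure_of_finite ht)
      rw [Set.singleton_add] at h
      exact h
    rw [Set.sUnion_insert]
    -- The induction hypothesis covers only nonempty unions.
    rcases (⋃₀ S).eq_empty_or_nonempty with h0 | h0
    · rwa [h0, Set.union_empty]
    · exact hs.union (ih (fun t ht => hlin t (Set.mem_insert_of_mem _ ht)) h0)

theorem fg_multiset (Δ : Type u) [Finite Δ] : AddMonoid.FG (Multiset Δ) := by
  refine ⟨(AddSubmonoid.fg_iff _).2 ⟨Set.range fun a : Δ => ({a} : Multiset Δ), ?_,
    Set.finite_range _⟩⟩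
  refine eq_top_iff.2 fun x _ => ?_
  induction x using Multiset.induction_on with
  | empty => exact zero_mem _
  | cons a x ih =>
    rw [← Multiset.singleton_add]
    exact add_mem (AddSubmonoid.subset_closure ⟨a, rfl⟩) (ih trivial)

theorem isSemilinearSet_preimage_map {Δ : Type u} {Δ' : Type v} [Finite Δ] (f : Δ → Δ')
    {L : BagLang Δ'} (h : IsSemilinearSet L) : IsSemilinearSet (Multiset.map f ⁻¹' L) :=
  have := fg_multiset Δ
  h.preimage (Multiset.mapAddMonoidHom f)

theorem isSemilinearSet_distJoin {Lab : Type u} [Finite Lab] {Γ₁ Γ₂ : Type w} [Finite Γ₁]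
    [Finite Γ₂] {L₁ : BagLang (Lab × Γ₁)} {L₂ : BagLang (Lab × Γ₂)} (h₁ : IsSemilinearSet L₁)
    (h₂ : IsSemilinearSet L₂) : IsSemilinearSet (distJoin L₁ L₂) :=
  (isSemilinearSet_preimage_map (fun p : Lab × (Γ₁ × Γ₂) => (p.1, p.2.1)) h₁).inter
    (isSemilinearSet_preimage_map (fun p : Lab × (Γ₁ × Γ₂) => (p.1, p.2.2)) h₂)

/-! ### Typings as choices of a type for each edge -/

/-- `Nodup` is essential: two copies of one element could be matched with different partners, which
no function records. -/
theorem exists_choice_of_rel {α : Type u} {β : Type v} [Nonempty β] {r : α → β → Prop}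
    {s : Multiset α} (hs : s.Nodup) {y : Multiset β} (h : Multiset.Rel r s y) :
    ∃ c : α → β, (∀ a ∈ s, r a (c a)) ∧ s.map c = y := by
  classical
  induction s using Multiset.induction_on generalizing y with
  | empty =>
    rw [Multiset.rel_zero_left] at h
    exact ⟨fun _ => Classical.arbitrary β, by simp, by simp [h]⟩
  | cons a s ih =>
    obtain ⟨b, y', hab, hy', rfl⟩ := Multiset.rel_cons_left.1 h
    obtain ⟨has, hs'⟩ := Multiset.nodup_cons.1 hs
    obtain ⟨c, hc, rfl⟩ := ih hs' hy'
    have hne : ∀ x ∈ s, Function.update c a b x = c x := fun x hx =>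
      Function.update_of_ne (by rintro rfl; exact has hx) _ _
    refine ⟨Function.update c a b, fun x hx => ?_, ?_⟩
    · rcases Multiset.mem_cons.1 hx with rfl | hx
      · simpa using hab
      · rw [hne x hx]
        exact hc x hx
    · rw [Multiset.map_cons, Function.update_self, Multiset.map_congr rfl hne]

/-- The out-neighbourhood of `n` with its edges typed by `c`, where `c` may depend on the edge. -/
noncomputable def LGraph.outLabChoice {Lab : Type u} [Finite Lab] (G : LGraph.{u, v} Lab)
    {T : Type w} (n : G.V) (c : Lab × G.V → T) : Multiset (Lab × T) :=
  (Set.toFinite (G.outLabNode n)).toFinset.val.map fun p => (p.1, c p)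

section

variable {Lab : Type u} [Finite Lab]

theorem LGraph.map_outLabChoice (G : LGraph.{u, v} Lab) {T T' : Type w} (n : G.V)
    (c : Lab × G.V → T) (f : T → T') :
    (G.outLabChoice n c).map (fun p => (p.1, f p.2)) = G.outLabChoice n (fun p => f (c p)) := by
  simp [LGraph.outLabChoice]

theorem LGraph.outLabChoice_congr (G : LGraph.{u, v} Lab) {T : Type w} {n : G.V}
    {c c' : Lab × G.V → T} (h : ∀ p ∈ G.outLabNode n, c p = c' p) :
    G.outLabChoice n c = G.outLabChoice n c' :=
  Multiset.map_congr rfl fun p hp => by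
    rw [h p ((Set.toFinite (G.outLabNode n)).mem_toFinset.1 hp)]

theorem LGraph.exists_of_mem_outLabChoice (G : LGraph.{u, v} Lab) {T : Type w} {n : G.V}
    {c : Lab × G.V → T} {q : Lab × T} (h : q ∈ G.outLabChoice n c) :
    ∃ p ∈ G.outLabNode n, c p = q.2 := by
  obtain ⟨p, hp, rfl⟩ := Multiset.mem_map.1 h
  exact ⟨p, (Set.toFinite (G.outLabNode n)).mem_toFinset.1 hp, rfl⟩

theorem LGraph.mem_outLabTypes_iff (G : LGraph.{u, v} Lab) {Γ : Type w} [Nonempty Γ]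
    (typ : G.V → Set Γ) (n : G.V) (y : Multiset (Lab × Γ)) :
    y ∈ G.outLabTypes typ n ↔
      ∃ c : Lab × G.V → Γ, (∀ p ∈ G.outLabNode n, c p ∈ typ p.2) ∧ G.outLabChoice n c = y := by
  rw [LGraph.outLabTypes, Set.mem_ofPred_eq, IsFlattening, LGraph.outLabType,
    Multiset.rel_map_left]
  constructor
  · intro h
    have hy : ∃ c : Lab × G.V → Lab × Γ, (∀ p ∈ (Set.toFinite (G.outLabNode n)).toFinset.val,
        (c p).1 = p.1 ∧ (c p).2 ∈ typ p.2) ∧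
        (Set.toFinite (G.outLabNode n)).toFinset.val.map c = y := by
      -- `exists_choice_of_rel` needs `Lab × Γ` to be inhabited; without labels all bags are empty.
      rcases isEmpty_or_nonempty Lab with hL | hL
      · have hy : y = 0 := Multiset.eq_zero_of_forall_notMem fun p => isEmptyElim p.1
        exact ⟨fun p => isEmptyElim p.1, fun p => isEmptyElim p.1, hy ▸
          Multiset.eq_zero_of_forall_notMem fun p => isEmptyElim p.1⟩
      · exact exists_choice_of_rel (Finset.nodup _) h
    obtain ⟨c, hc, rfl⟩ := hy
    refine ⟨fun p => (c p).2, fun p hp => (hc p ?_).2, Multiset.map_congr rfl fun p hp => ?_⟩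
    · exact (Set.toFinite (G.outLabNode n)).mem_toFinset.2 hp
    · exact Prod.ext (hc p hp).1.symm rfl
  · rintro ⟨c, hc, rfl⟩
    refine Multiset.rel_map_right.2 (Multiset.rel_refl_of_refl_on fun p hp => ⟨rfl, ?_⟩)
    exact hc p ((Set.toFinite (G.outLabNode n)).mem_toFinset.1 hp)

theorem Schema.validM_iff (S : Schema.{u, w} Lab) (G : LGraph.{u, v} Lab)
    (typ : G.V → Set S.Γ) :
    S.ValidM G typ ↔ (∀ n, (typ n).Nonempty) ∧ ∀ n, ∀ t ∈ typ n, ∃ c : Lab × G.V → S.Γ,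
      (∀ p ∈ G.outLabNode n, c p ∈ typ p.2) ∧ G.outLabChoice n c ∈ S.δ t := by
  refine and_congr_right fun _ => forall_congr' fun n => forall₂_congr fun t _ => ?_
  have : Nonempty S.Γ := ⟨t⟩
  constructor
  · rintro ⟨y, hy, hyt⟩
    obtain ⟨c, hc, rfl⟩ := (G.mem_outLabTypes_iff typ n y).1 hy
    exact ⟨c, hc, hyt⟩
  · rintro ⟨c, hc, hct⟩
    exact ⟨_, (G.mem_outLabTypes_iff typ n _).2 ⟨c, hc, rfl⟩, hct⟩

/-! ### The product schema -/

/-- Serves both semantics: an s-typing is the choice `fun p => typ p.2`, up to definitional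
unfolding. -/
theorem Schema.mem_prod_δ (S₁ S₂ : Schema.{u, w} Lab) (G : LGraph.{u, v} Lab) (n : G.V)
    (c : Lab × G.V → S₁.Γ × S₂.Γ) (t : S₁.Γ × S₂.Γ) :
    G.outLabChoice n c ∈ (S₁.prod S₂).δ t ↔
      G.outLabChoice n (fun p => (c p).1) ∈ S₁.δ t.1 ∧
        G.outLabChoice n (fun p => (c p).2) ∈ S₂.δ t.2 := by
  rw [← G.map_outLabChoice n c Prod.fst, ← G.map_outLabChoice n c Prod.snd]
  rfl

theorem Schema.langS_prod (S₁ S₂ : Schema.{u, w} Lab) :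
    ((S₁.prod S₂).langS : Set (LGraph.{u, v} Lab)) = S₁.langS ∩ S₂.langS := by
  ext G
  constructor
  · rintro ⟨typ, h⟩
    have h' := fun n => (S₁.mem_prod_δ S₂ G n _ _).1 (h n)
    exact ⟨⟨fun n => (typ n).1, fun n => (h' n).1⟩, ⟨fun n => (typ n).2, fun n => (h' n).2⟩⟩
  · rintro ⟨⟨typ₁, h₁⟩, ⟨typ₂, h₂⟩⟩
    exact ⟨fun n => (typ₁ n, typ₂ n), fun n => (S₁.mem_prod_δ S₂ G n _ _).2 ⟨h₁ n, h₂ n⟩⟩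

theorem Schema.langM_prod (S₁ S₂ : Schema.{u, w} Lab) :
    ((S₁.prod S₂).langM : Set (LGraph.{u, v} Lab)) = S₁.langM ∩ S₂.langM := by
  ext G
  constructor
  · rintro ⟨typ, h⟩
    obtain ⟨hne, h⟩ := (Schema.validM_iff _ _ _).1 h
    constructor
    · refine ⟨fun n => Prod.fst '' typ n, (Schema.validM_iff _ _ _).2
        ⟨fun n => (hne n).image _, ?_⟩⟩
      rintro n _ ⟨t, ht, rfl⟩
      obtain ⟨c, hc, hct⟩ := h n t ht
      exact ⟨fun p => (c p).1, fun p hp => ⟨c p, hc p hp, rfl⟩,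
        ((S₁.mem_prod_δ S₂ G n _ _).1 hct).1⟩
    · refine ⟨fun n => Prod.snd '' typ n, (Schema.validM_iff _ _ _).2
        ⟨fun n => (hne n).image _, ?_⟩⟩
      rintro n _ ⟨t, ht, rfl⟩
      obtain ⟨c, hc, hct⟩ := h n t ht
      exact ⟨fun p => (c p).2, fun p hp => ⟨c p, hc p hp, rfl⟩,
        ((S₁.mem_prod_δ S₂ G n _ _).1 hct).2⟩
  · rintro ⟨⟨typ₁, h₁⟩, ⟨typ₂, h₂⟩⟩
    obtain ⟨hne₁, h₁⟩ := (Schema.validM_iff _ _ _).1 h₁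
    obtain ⟨hne₂, h₂⟩ := (Schema.validM_iff _ _ _).1 h₂
    -- The full product of the type sets works because the edge choices for the two components are
    -- independent.
    refine ⟨fun n => typ₁ n ×ˢ typ₂ n, (Schema.validM_iff _ _ _).2
      ⟨fun n => (hne₁ n).prod (hne₂ n), ?_⟩⟩
    rintro n t ⟨ht₁, ht₂⟩
    obtain ⟨c₁, hc₁, hct₁⟩ := h₁ n _ ht₁
    obtain ⟨c₂, hc₂, hct₂⟩ := h₂ n _ ht₂
    exact ⟨fun p => (c₁ p, c₂ p), fun p hp => ⟨hc₁ p hp, hc₂ p hp⟩,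
      (S₁.mem_prod_δ S₂ G n _ _).2 ⟨hct₁, hct₂⟩⟩

end

/-! ### Trimming a schema to its supported types -/

section

variable {Lab : Type u}

/-- A set of types is self-supporting if each of its types admits a bag over that set. -/
def Schema.IsSupported (S : Schema.{u, w} Lab) (A : Set S.Γ) : Prop :=
  ∀ t ∈ A, ∃ x ∈ S.δ t, ∀ p ∈ x, p.2 ∈ A

/-- The largest self-supporting set of types. -/
def Schema.support (S : Schema.{u, w} Lab) : Set S.Γ :=
  ⋃₀ {A | S.IsSupported A}

theorem Schema.IsSupported.subset_support {S : Schema.{u, w} Lab} {A : Set S.Γ}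
    (h : S.IsSupported A) : A ⊆ S.support :=
  Set.subset_sUnion_of_mem h

theorem Schema.isSupported_support (S : Schema.{u, w} Lab) : S.IsSupported S.support := by
  rintro t ⟨A, hA, ht⟩
  obtain ⟨x, hx, hxA⟩ := hA t ht
  exact ⟨x, hx, fun p hp => hA.subset_support (hxA p hp)⟩

/-- The restriction of a schema to its largest self-supporting set of types. -/
def Schema.trim (S : Schema.{u, w} Lab) : Schema.{u, w} Lab where
  Γ := S.support
  finΓ := inferInstance
  δ := fun t => Multiset.map (fun p => (p.1, (p.2 : S.Γ))) ⁻¹' S.δ t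

theorem Schema.trim_δ_nonempty (S : Schema.{u, w} Lab) (t : S.trim.Γ) : (S.trim.δ t).Nonempty := by
  obtain ⟨x, hx, hxA⟩ := S.isSupported_support t.1 t.2
  refine ⟨x.pmap (fun p hp => (p.1, ⟨p.2, hp⟩)) hxA, ?_⟩
  have h : (x.pmap (fun p hp => (p.1, (⟨p.2, hp⟩ : S.support))) hxA).map
      (fun p => (p.1, (p.2 : S.Γ))) = x := by
    rw [Multiset.map_pmap]
    exact (Multiset.pmap_eq_map (fun p : Lab × S.Γ => p.2 ∈ S.support) id x hxA).trans x.map_id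
  exact Set.mem_preimage.2 (h.symm ▸ hx)

variable [Finite Lab]

/-- Only semilinearity is assumed, because `S` will be a product, whose definitions may be empty. -/
theorem Schema.isShEx_trim (S : Schema.{u, w} Lab) (h : ∀ t, IsSemilinearSet (S.δ t)) :
    S.trim.IsShEx := fun t =>
  isRBE_of_isSemilinearSet (isSemilinearSet_preimage_map
    (fun p : Lab × S.support => (p.1, (p.2 : S.Γ))) (h t.1)) (S.trim_δ_nonempty t)

theorem Schema.mem_trim_δ (S : Schema.{u, w} Lab) (G : LGraph.{u, v} Lab) (n : G.V)
    (c : Lab × G.V → S.support) (t : S.support) :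
    G.outLabChoice n c ∈ S.trim.δ t ↔ G.outLabChoice n (fun p => (c p : S.Γ)) ∈ S.δ t := by
  rw [← G.map_outLabChoice n c Subtype.val]
  rfl

theorem Schema.langS_trim (S : Schema.{u, w} Lab) :
    (S.trim.langS : Set (LGraph.{u, v} Lab)) = S.langS := by
  ext G
  constructor
  · rintro ⟨typ, h⟩
    exact ⟨fun n => (typ n).1, fun n => (S.mem_trim_δ G n _ _).1 (h n)⟩
  · rintro ⟨typ, h⟩
    -- The out-neighbourhood of a node is itself a supporting bag for the type of that node.
    have hA : S.IsSupported (Set.range typ) := by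
      rintro _ ⟨n, rfl⟩
      refine ⟨_, h n, fun p hp => ?_⟩
      obtain ⟨q, _, hq⟩ := G.exists_of_mem_outLabChoice hp
      exact ⟨q.2, hq⟩
    exact ⟨fun n => ⟨typ n, hA.subset_support ⟨n, rfl⟩⟩,
      fun n => (S.mem_trim_δ G n _ _).2 (h n)⟩

theorem Schema.langM_trim (S : Schema.{u, w} Lab) :
    (S.trim.langM : Set (LGraph.{u, v} Lab)) = S.langM := by
  classical
  ext G
  constructor
  · rintro ⟨typ, h⟩
    obtain ⟨hne, h⟩ := (Schema.validM_iff _ _ _).1 h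
    refine ⟨fun n => Subtype.val '' typ n, (Schema.validM_iff _ _ _).2
      ⟨fun n => (hne n).image _, ?_⟩⟩
    rintro n _ ⟨t, ht, rfl⟩
    obtain ⟨c, hc, hct⟩ := h n t ht
    exact ⟨fun p => (c p).1, fun p hp => ⟨c p, hc p hp, rfl⟩, (S.mem_trim_δ G n _ _).1 hct⟩
  · rintro ⟨typ, h⟩
    obtain ⟨hne, h⟩ := (Schema.validM_iff _ _ _).1 h
    have hA : S.IsSupported (⋃ n, typ n) := by
      intro t ht
      obtain ⟨n, hn⟩ := Set.mem_iUnion.1 ht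
      obtain ⟨c, hc, hct⟩ := h n t hn
      refine ⟨_, hct, fun p hp => ?_⟩
      obtain ⟨q, hq, hqp⟩ := G.exists_of_mem_outLabChoice hp
      exact Set.mem_iUnion.2 ⟨q.2, hqp ▸ hc q hq⟩
    have hsub : ∀ n, ∀ t ∈ typ n, t ∈ S.support := fun n t ht =>
      hA.subset_support (Set.mem_iUnion.2 ⟨n, ht⟩)
    refine ⟨fun n => Subtype.val ⁻¹' typ n, (Schema.validM_iff _ _ _).2 ⟨fun n => ?_, ?_⟩⟩
    · obtain ⟨t, ht⟩ := hne n
      exact ⟨⟨t, hsub n t ht⟩, ht⟩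
    · intro n t ht
      obtain ⟨c, hc, hct⟩ := h n t.1 ht
      -- Off the edges of `n` the value `t` is a dummy; `outLabChoice_congr` ignores it.
      let c' : Lab × G.V → S.support := fun p =>
        if hp : p ∈ G.outLabNode n then ⟨c p, hsub p.2 _ (hc p hp)⟩ else t
      have hc' : ∀ p ∈ G.outLabNode n, (c' p : S.Γ) = c p := fun p hp => by simp [c', hp]
      refine ⟨c', fun p hp => ?_, (S.mem_trim_δ G n c' t).2 ?_⟩
      · change (c' p : S.Γ) ∈ typ p.2
        exact (hc' p hp).symm ▸ hc p hp
      · rwa [G.outLabChoice_congr hc']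

theorem Schema.isSemilinearSet_prod_δ {S₁ S₂ : Schema.{u, w} Lab} (h₁ : S₁.IsShEx)
    (h₂ : S₂.IsShEx) (t : (S₁.prod S₂).Γ) : IsSemilinearSet ((S₁.prod S₂).δ t) :=
  isSemilinearSet_distJoin (h₁ t.1).isSemilinearSet (h₂ t.2).isSemilinearSet

end

end ShEx

theorem mainTheorem2 (Lab : Type u) [Finite Lab] :
    -- ShExS and ShExM are closed under intersection
    (∀ K₁ ∈ ShEx.ShExS.{u, v, w} Lab, ∀ K₂ ∈ ShEx.ShExS.{u, v, w} Lab,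
      K₁ ∩ K₂ ∈ ShEx.ShExS.{u, v, w} Lab) ∧
    (∀ K₁ ∈ ShEx.ShExM.{u, v, w} Lab, ∀ K₂ ∈ ShEx.ShExM.{u, v, w} Lab,
      K₁ ∩ K₂ ∈ ShEx.ShExM.{u, v, w} Lab) ∧
    -- the product schema defines the intersection under both semantics
    (∀ S₁ S₂ : ShEx.Schema.{u, w} Lab,
      ((S₁.prod S₂).langS : Set (ShEx.LGraph.{u, v} Lab)) = S₁.langS ∩ S₂.langS ∧
      ((S₁.prod S₂).langM : Set (ShEx.LGraph.{u, v} Lab)) = S₁.langM ∩ S₂.langM) ∧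
    -- a distributing join of RBE languages is an RBE language, unless it is empty
    (∀ (Γ₁ Γ₂ : Type w) [Finite Γ₁] [Finite Γ₂]
      (L₁ : ShEx.BagLang (Lab × Γ₁)) (L₂ : ShEx.BagLang (Lab × Γ₂)),
      ShEx.IsRBE L₁ → ShEx.IsRBE L₂ → (ShEx.distJoin L₁ L₂).Nonempty →
        ShEx.IsRBE (ShEx.distJoin L₁ L₂)) := by
  refine ⟨?_, ?_, fun S₁ S₂ => ⟨S₁.langS_prod S₂, S₁.langM_prod S₂⟩, ?_⟩
  · rintro _ ⟨S₁, h₁, rfl⟩ _ ⟨S₂, h₂, rfl⟩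
    exact ⟨(S₁.prod S₂).trim, ShEx.Schema.isShEx_trim _ (ShEx.Schema.isSemilinearSet_prod_δ h₁ h₂),
      (ShEx.Schema.langS_trim _).trans (ShEx.Schema.langS_prod _ _)⟩
  · rintro _ ⟨S₁, h₁, rfl⟩ _ ⟨S₂, h₂, rfl⟩
    exact ⟨(S₁.prod S₂).trim, ShEx.Schema.isShEx_trim _ (ShEx.Schema.isSemilinearSet_prod_δ h₁ h₂),
      (ShEx.Schema.langM_trim _).trans (ShEx.Schema.langM_prod _ _)⟩
  · intro Γ₁ Γ₂ _ _ L₁ L₂ h₁ h₂ hne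
    exact ShEx.isRBE_of_isSemilinearSet
      (ShEx.isSemilinearSet_distJoin h₁.isSemilinearSet h₂.isSemilinearSet) hne
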